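/- Let $f:\{0,1\}^n\times\{0,1\}^n\to\{0,1\}$. A labeled rectangle is a product set $A\times B\subseteq\{0,1\}^n\times\{0,1\}^n$ together with a label in $\{0,1\}$; a rectangle is adjacent to an input $(x,y)$ if it contains $(x,y)$. A majority cover for $f$ is a finite family of labeled rectangles (repetitions allowed) such that for each input $(x,y)$ the majority of the adjacent rectangles bears the label $f(x,y)$, where ties are broken in favor of the value $1$; that is, $f(x,y)=1$ if and only if at least as many adjacent rectangles bear the label $1$ as bear the label $0$. An approximate majority cover for $f$ is a majority cover for $f$ in which, for each input $(x,y)$, at least $3/4$ of the adjacent rectangles bear the label $f(x,y)$. The size of a cover is its number of rectangles, counted with multiplicity. Let $PP(f)$ and $APP(f)$ be the logarithms to base $2$ of the smallest size of a majority cover for $f$ and of an approximate majority cover for $f$, respectively. For each $n$ let $MAJ:\{0,1\}^n\times\{0,1\}^n\to\{0,1\}$ be the function with \[MAJ(x,y)=1\iff \sum_{i=1}^n (x_i\wedge y_i)\ge n/2 .\] **Theorem.** As $n\to\infty$, \[PP(MAJ)=O(\log n)\qquad\text{and}\qquad APP(MAJ)=\Omega(n).\] -/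

import Mathlib

open Filter Asymptotics

/-- Bit strings of length `n`. -/
abbrev BitString (n : ℕ) : Type := Fin n → Bool

/-- A labeled rectangle in the communication matrix of a function on
`BitString n × BitString n`: the product set `rows × cols` with a label in `{0,1}`. -/
structure LabeledRectangle (n : ℕ) where
  rows : Finset (BitString n)
  cols : Finset (BitString n)
  label : Bool

/-- The input `(x, y)` lies in the rectangle `R` (they are adjacent). -/
def LabeledRectangle.Adjacent {n : ℕ} (R : LabeledRectangle n) (x y : BitString n) : Prop :=
  x ∈ R.rows ∧ y ∈ R.cols

instance LabeledRectangle.decidableAdjacent {n : ℕ} (R : LabeledRectangle n)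
    (x y : BitString n) : Decidable (R.Adjacent x y) :=
  inferInstanceAs (Decidable (x ∈ R.rows ∧ y ∈ R.cols))

/-- The number, with multiplicity, of rectangles of the family `C` that contain `(x, y)` and
bear the label `b`. -/
def adjacentCount {n : ℕ} (C : Multiset (LabeledRectangle n)) (b : Bool)
    (x y : BitString n) : ℕ :=
  C.countP (fun R => R.Adjacent x y ∧ R.label = b)

/-- `C` is a majority cover for `f`: at every input the majority of the adjacent rectangles
bears the correct label, where ties are broken in favor of the value `1`. Rectangles may be
used several times. -/
def IsMajorityCover {n : ℕ} (f : BitString n → BitString n → Bool)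
    (C : Multiset (LabeledRectangle n)) : Prop :=
  ∀ x y, f x y = true ↔ adjacentCount C false x y ≤ adjacentCount C true x y

/-- `C` is an approximate majority cover for `f`: a majority cover in which at every input at
least `3/4` of the adjacent rectangles bear the correct label. -/
def IsApproxMajorityCover {n : ℕ} (f : BitString n → BitString n → Bool)
    (C : Multiset (LabeledRectangle n)) : Prop :=
  IsMajorityCover f C ∧
    ∀ x y, (3 / 4 : ℚ) * (C.countP (fun R => R.Adjacent x y) : ℚ) ≤
      (adjacentCount C (f x y) x y : ℚ)

/-- Labeling every single entry correctly gives an approximate majority cover, so the minima in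
the definitions of `PP` and `APP` are over nonempty sets. -/
theorem exists_isApproxMajorityCover {n : ℕ} (f : BitString n → BitString n → Bool) :
    ∃ C : Multiset (LabeledRectangle n), IsApproxMajorityCover f C := by
  let g : BitString n × BitString n → LabeledRectangle n := fun p => ⟨{p.1}, {p.2}, f p.1 p.2⟩
  have key : ∀ x y b, adjacentCount ((Finset.univ : Finset (BitString n × BitString n)).val.map g)
      b x y = if f x y = b then 1 else 0 := by
    intro x y b
    have h : (Finset.univ.filter fun p : BitString n × BitString n =>
        (g p).Adjacent x y ∧ (g p).label = b) = if f x y = b then {(x, y)} else ∅ := by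
      ext ⟨u, v⟩
      split_ifs with hb <;> simp [g, LabeledRectangle.Adjacent] <;> grind
    unfold adjacentCount
    rw [Multiset.countP_map, ← Finset.filter_val, Finset.card_val, h]
    split_ifs <;> simp
  have tot : ∀ x y, ((Finset.univ : Finset (BitString n × BitString n)).val.map g).countP
      (fun R => R.Adjacent x y) = 1 := by
    intro x y
    have h : (Finset.univ.filter fun p : BitString n × BitString n =>
        (g p).Adjacent x y) = {(x, y)} := by
      ext ⟨u, v⟩
      simp [g, LabeledRectangle.Adjacent]
      grind
    rw [Multiset.countP_map, ← Finset.filter_val, Finset.card_val, h]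
    simp
  refine ⟨(Finset.univ : Finset (BitString n × BitString n)).val.map g, fun x y => ?_, fun x y => ?_⟩
  · rw [key, key]
    cases f x y <;> simp
  · rw [key, tot]
    norm_num

/-- The size of a smallest majority cover for `f`. -/
noncomputable def minMajorityCover {n : ℕ} (f : BitString n → BitString n → Bool) : ℕ :=
  sInf {s | ∃ C : Multiset (LabeledRectangle n), IsMajorityCover f C ∧ C.card = s}

/-- The size of a smallest approximate majority cover for `f`. -/
noncomputable def minApproxMajorityCover {n : ℕ} (f : BitString n → BitString n → Bool) : ℕ :=
  sInf {s | ∃ C : Multiset (LabeledRectangle n), IsApproxMajorityCover f C ∧ C.card = s}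

/-- The majority cover complexity of `f`. -/
noncomputable def PP {n : ℕ} (f : BitString n → BitString n → Bool) : ℝ :=
  Real.logb 2 (minMajorityCover f)

/-- The approximate majority cover complexity of `f`. -/
noncomputable def APP {n : ℕ} (f : BitString n → BitString n → Bool) : ℝ :=
  Real.logb 2 (minApproxMajorityCover f)

/-- `MAJ(x, y) = 1` iff `∑ i, (x_i ∧ y_i) ≥ n / 2`. -/
def MAJ (n : ℕ) (x y : BitString n) : Bool :=
  decide ((n : ℚ) / 2 ≤ ((∑ i, (x i && y i).toNat : ℕ) : ℚ))

/-! The upper bound is explicit: take each rectangle `{x_i = 1} × {y_i = 1}` twice with label 1, and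
the whole matrix `n` times with label 0.

The lower bound rests on Razborov's corruption argument. In a ground set of size `4l - 1`, two
`2l`-sets `V`, `V'` that cover it and share one point `i` carry both disjoint pairs of `l`-sets
(both avoiding `i`) and pairs meeting in `i` (both containing it). If a set family on the middle
layer of `V` seldom contains many of the points, it is exponentially small; otherwise, at most `i`,
containing `i` costs only a constant factor. Hence a rectangle's mass on disjoint pairs is at most
128 times its mass on uniquely meeting pairs, up to an exponentially small error
(`disjointWeight_le_meetingWeight`).

Averaging over permutations moves this to pairs in `Fin n` whose intersection sizes differ by one
(`permSum_mul_le`). Complementing one side gives the reverse direction (`permSum_sum_mul_le_compl`).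

In an approximate cover, right labels outnumber wrong ones 3 to 1. Fifth powers of the label counts
are still sums of products, now `|C|^5` of them, and raise the ratio to `243 > 128`. Going from
intersection size just below `n/2` to just above and back then bounds the mass of label 0 by a
fraction of itself plus error, so `|C|^5` must be exponentially large
(`one_le_of_isApproxMajorityCover`). -/

/-! ### Corruption bound for disjointness. -/

section Corruption

variable {ι : Type*} {l : ℕ} {a b : Finset ι → ℝ} {V : Finset ι}

/-- The total weight of the `l`-subsets of `V`. -/
def layerWeight (l : ℕ) (a : Finset ι → ℝ) (V : Finset ι) : ℝ :=
  ∑ x ∈ V.powersetCard l, a x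

lemma layerWeight_nonneg (ha : ∀ x, 0 ≤ a x) : 0 ≤ layerWeight l a V :=
  Finset.sum_nonneg fun x _ => ha x

lemma layerWeight_le_choose (ha : ∀ x, a x ≤ 1) : layerWeight l a V ≤ (V.card.choose l : ℝ) := by
  refine (Finset.sum_le_sum fun x _ => ha x).trans ?_
  simp

/-- The pairs `(V, i)` with `V` a `2l`-subset of `K` and `i ∈ V`. -/
def pointedSubsets (K : Finset ι) (l : ℕ) : Finset ((_ : Finset ι) × ι) :=
  (K.powersetCard (2 * l)).sigma fun V => V

lemma mem_pointedSubsets {K : Finset ι} {p : (_ : Finset ι) × ι} :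
    p ∈ pointedSubsets K l ↔ (p.1 ⊆ K ∧ p.1.card = 2 * l) ∧ p.2 ∈ p.1 := by
  simp [pointedSubsets]

variable [DecidableEq ι]

/-- The total weight of the `l`-subsets of `V` that contain `i`. -/
def layerWeightIn (l : ℕ) (a : Finset ι → ℝ) (V : Finset ι) (i : ι) : ℝ :=
  ∑ x ∈ (V.powersetCard l).filter (fun x => i ∈ x), a x

/-- The total weight of the `l`-subsets of `V` that avoid `i`. -/
def layerWeightOut (l : ℕ) (a : Finset ι → ℝ) (V : Finset ι) (i : ι) : ℝ :=
  ∑ x ∈ (V.powersetCard l).filter (fun x => i ∉ x), a x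

lemma layerWeightIn_add_layerWeightOut (l : ℕ) (a : Finset ι → ℝ) (V : Finset ι) (i : ι) :
    layerWeightIn l a V i + layerWeightOut l a V i = layerWeight l a V :=
  Finset.sum_filter_add_sum_filter_not _ _ _

lemma layerWeightIn_nonneg (ha : ∀ x, 0 ≤ a x) (i : ι) : 0 ≤ layerWeightIn l a V i :=
  Finset.sum_nonneg fun x _ => ha x

lemma layerWeightOut_nonneg (ha : ∀ x, 0 ≤ a x) (i : ι) : 0 ≤ layerWeightOut l a V i :=
  Finset.sum_nonneg fun x _ => ha x

lemma layerWeightOut_le (ha : ∀ x, 0 ≤ a x) (i : ι) :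
    layerWeightOut l a V i ≤ layerWeight l a V := by
  have := layerWeightIn_add_layerWeightOut l a V i
  linarith [layerWeightIn_nonneg (l := l) (V := V) ha i]

lemma layerWeightOut_eq_layerWeight_erase (l : ℕ) (a : Finset ι → ℝ) (V : Finset ι) (i : ι) :
    layerWeightOut l a V i = layerWeight l a (V.erase i) := by
  unfold layerWeightOut layerWeight
  congr 1
  ext x
  simp only [Finset.mem_filter, Finset.mem_powersetCard, Finset.subset_erase]
  tauto

lemma sum_layerWeightIn (l : ℕ) (a : Finset ι → ℝ) (V B : Finset ι) :
    ∑ i ∈ B, layerWeightIn l a V i =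
      ∑ x ∈ V.powersetCard l, a x * ((x ∩ B).card : ℝ) := by
  simp only [layerWeightIn, Finset.sum_filter]
  rw [Finset.sum_comm]
  refine Finset.sum_congr rfl fun x _ => ?_
  rw [← Finset.sum_filter, Finset.sum_const, nsmul_eq_mul, mul_comm, Finset.filter_mem_eq_inter,
    Finset.inter_comm]

/-- Double counting: an `l`-subset of a `2l`-set contains `l` points and omits `l`. -/
lemma sum_layerWeightOut (hV : V.card = 2 * l) :
    ∑ i ∈ V, layerWeightOut l a V i = l * layerWeight l a V := by
  have h1 : ∑ i ∈ V, layerWeightIn l a V i = l * layerWeight l a V := by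
    rw [sum_layerWeightIn, layerWeight, Finset.mul_sum]
    refine Finset.sum_congr rfl fun x hx => ?_
    rw [Finset.mem_powersetCard] at hx
    rw [Finset.inter_eq_left.2 hx.1, hx.2, mul_comm]
  have h2 : ∑ i ∈ V, (layerWeightIn l a V i + layerWeightOut l a V i) =
      2 * l * layerWeight l a V := by
    simp [layerWeightIn_add_layerWeightOut, hV]
  rw [Finset.sum_add_distrib] at h2
  linarith

/-- Expand a product over `V` with factor `1 + t` on `B` and `1 + 1` elsewhere. -/
lemma sum_powerset_pow_card_inter (t : ℝ) {V B : Finset ι} (hB : B ⊆ V) :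
    ∑ x ∈ V.powerset, t ^ (x ∩ B).card = (1 + t) ^ B.card * 2 ^ (V.card - B.card) := by
  have h := Finset.prod_one_add (f := fun i => if i ∈ B then t else 1) V
  have h1 : ∀ x : Finset ι, ∏ i ∈ x, (if i ∈ B then t else 1) = t ^ (x ∩ B).card := fun x => by
    rw [← Finset.prod_filter, Finset.prod_const, Finset.filter_mem_eq_inter]
  simp only [h1] at h
  rw [← h, ← Finset.sdiff_union_of_subset hB, Finset.prod_union Finset.sdiff_disjoint,
    Finset.sdiff_union_of_subset hB, mul_comm]
  congr 1
  · rw [Finset.prod_congr rfl (g := fun _ => 1 + t) (fun i hi => by simp [hi])]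
    simp
  · rw [Finset.prod_congr rfl (g := fun _ => (2 : ℝ))
      (fun i hi => by simp [(Finset.mem_sdiff.1 hi).2]; norm_num)]
    simp [Finset.card_sdiff_of_subset hB]

/-- A weight on the middle layer of a cube that rarely contains the elements of `B` is
exponentially small in the size of `B`. -/
lemma layerWeight_le_of_sum_layerWeightIn_le (ha0 : ∀ x, 0 ≤ a x) (ha1 : ∀ x, a x ≤ 1)
    (hV : V.card = 2 * l) {B : Finset ι} (hB : B ⊆ V) (hB0 : B.Nonempty)
    (h : ∑ i ∈ B, layerWeightIn l a V i ≤ B.card * (layerWeight l a V / 8)) :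
    layerWeight l a V ≤ 2 * 4 ^ l * (97 / 108 : ℝ) ^ B.card := by
  have hpos : (0 : ℝ) < B.card := by exact_mod_cast hB0.card_pos
  rw [sum_layerWeightIn] at h
  -- Markov's inequality: the average of `|x ∩ B|` is at most `|B|/8`, so the sets above twice that
  -- carry at most half the weight.
  set good := (V.powersetCard l).filter (fun x => 4 * (x ∩ B).card ≤ B.card) with hgood
  set bad := (V.powersetCard l).filter (fun x => ¬ 4 * (x ∩ B).card ≤ B.card) with hbad
  have hsplit : ∑ x ∈ good, a x + ∑ x ∈ bad, a x = layerWeight l a V :=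
    Finset.sum_filter_add_sum_filter_not _ _ _
  have hb : (B.card : ℝ) * ∑ x ∈ bad, a x ≤
      4 * ∑ x ∈ V.powersetCard l, a x * ((x ∩ B).card : ℝ) := by
    rw [Finset.mul_sum, Finset.mul_sum]
    refine (Finset.sum_le_sum (g := fun x => 4 * (a x * ((x ∩ B).card : ℝ))) fun x hx => ?_).trans
      (Finset.sum_le_sum_of_subset_of_nonneg (Finset.filter_subset _ _) fun x _ _ =>
        mul_nonneg (by norm_num) (mul_nonneg (ha0 x) (Nat.cast_nonneg _)))
    have h1 : (B.card : ℝ) ≤ 4 * (x ∩ B).card := by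
      have := (Finset.mem_filter.1 hx).2
      exact_mod_cast (not_le.1 this).le
    nlinarith [ha0 x]
  have hbad_half : ∑ x ∈ bad, a x ≤ layerWeight l a V / 2 := by
    refine le_of_mul_le_mul_left ?_ hpos
    linarith
  -- A Chernoff bound with `t = 16/81 = (2/3)^4`: on `good`, `t ^ |x ∩ B|` is at least `(2/3) ^
  -- |B|`.
  have hg : (2 / 3 : ℝ) ^ B.card * ∑ x ∈ good, a x ≤
      ∑ x ∈ V.powerset, (16 / 81 : ℝ) ^ (x ∩ B).card := by
    rw [Finset.mul_sum]
    refine (Finset.sum_le_sum (g := fun x => (16 / 81 : ℝ) ^ (x ∩ B).card) fun x hx => ?_).trans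
      (Finset.sum_le_sum_of_subset_of_nonneg (fun x hx => ?_) fun x _ _ => by positivity)
    · have h1 := (Finset.mem_filter.1 hx).2
      have h2 : (16 / 81 : ℝ) ^ (x ∩ B).card = (2 / 3) ^ (4 * (x ∩ B).card) := by
        rw [pow_mul]; norm_num
      rw [h2]
      calc (2 / 3 : ℝ) ^ B.card * a x ≤ (2 / 3) ^ B.card * 1 := by gcongr; exact ha1 x
        _ ≤ _ := by
          rw [mul_one]; exact pow_le_pow_of_le_one (by norm_num) (by norm_num) h1
    · exact Finset.mem_powerset.2 (Finset.mem_powersetCard.1 (Finset.mem_filter.1 hx).1).1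
  rw [sum_powerset_pow_card_inter _ hB] at hg
  have hcard := Finset.card_le_card hB
  have h4 : (4 : ℝ) ^ l = 2 ^ (V.card - B.card) * 2 ^ B.card := by
    rw [← pow_add, Nat.sub_add_cancel hcard, hV, pow_mul]; norm_num
  have h5 : (97 / 108 : ℝ) ^ B.card * 2 ^ B.card * (2 / 3) ^ B.card = (1 + 16 / 81) ^ B.card := by
    rw [← mul_pow, ← mul_pow]; norm_num
  have h6 : ∑ x ∈ good, a x ≤ 4 ^ l * (97 / 108 : ℝ) ^ B.card := by
    refine le_of_mul_le_mul_left (hg.trans_eq ?_) (pow_pos (by norm_num : (0:ℝ) < 2/3) B.card)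
    rw [h4, ← h5]; ring
  linarith

/-- The upper bound on the weight of a middle layer with many rare elements. -/
noncomputable def rareBound (l : ℕ) : ℝ := 2 * 4 ^ l * (97 / 108 : ℝ) ^ (l / 4)

lemma rareBound_nonneg (l : ℕ) : 0 ≤ rareBound l := by unfold rareBound; positivity

/-- With at most `l/4` rare points, they contribute at most a quarter of the total `l * layerWeight
l a V`. With more, the whole layer weight is below `rareBound l`. -/
lemma sum_layerWeightOut_rare_le (ha0 : ∀ x, 0 ≤ a x) (ha1 : ∀ x, a x ≤ 1)
    (hV : V.card = 2 * l) :
    ∑ i ∈ V, (if layerWeightIn l a V i < layerWeightOut l a V i / 8 then layerWeightOut l a V i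
      else 0) ≤ (∑ i ∈ V, layerWeightOut l a V i) / 4 + 2 * l * rareBound l := by
  rw [sum_layerWeightOut hV, ← Finset.sum_filter]
  set B := V.filter (fun i => layerWeightIn l a V i < layerWeightOut l a V i / 8) with hBdef
  have hα := layerWeight_nonneg (l := l) (V := V) ha0
  have hsum : ∑ i ∈ B, layerWeightOut l a V i ≤ B.card * layerWeight l a V := by
    refine (Finset.sum_le_sum fun i _ => layerWeightOut_le ha0 i).trans_eq ?_
    simp
  have hη := rareBound_nonneg l
  by_cases hc : 4 * B.card ≤ l
  · have : (4 * B.card : ℝ) ≤ l := by exact_mod_cast hc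
    have h2 : (0:ℝ) ≤ 2 * l * rareBound l := by positivity
    nlinarith
  · have hBV : B ⊆ V := Finset.filter_subset _ _
    have hB0 : B.Nonempty := Finset.card_pos.1 (by omega)
    have h1 : layerWeight l a V ≤ rareBound l := by
      refine (layerWeight_le_of_sum_layerWeightIn_le ha0 ha1 hV hBV hB0 ?_).trans ?_
      · refine (Finset.sum_le_sum (g := fun _ => layerWeight l a V / 8) fun i hi => ?_).trans_eq
          (by simp)
        have := (Finset.mem_filter.1 hi).2
        linarith [layerWeightOut_le (l := l) (V := V) ha0 i]
      · unfold rareBound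
        refine mul_le_mul_of_nonneg_left ?_ (by positivity)
        exact pow_le_pow_of_le_one (by norm_num) (by norm_num) (by omega)
    have h2 : (B.card : ℝ) ≤ 2 * l := by
      have := Finset.card_le_card hBV
      rw [hV] at this
      exact_mod_cast this
    have h3 : (B.card : ℝ) * layerWeight l a V ≤ 2 * l * rareBound l := by gcongr
    have h4 : 0 ≤ (l : ℝ) * layerWeight l a V := by positivity
    linarith

/-! ### The involution exchanging the two sides, and the comparison of weights. -/

/-- The subset of `K` that meets `V` exactly in `i`, and is the complement of `V` elsewhere. -/
def coSubset (K V : Finset ι) (i : ι) : Finset ι := K \ V.erase i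

lemma coSubset_mem {K : Finset ι} (hK : K.card + 1 = 4 * l) {p : (_ : Finset ι) × ι}
    (hp : p ∈ pointedSubsets K l) :
    (⟨coSubset K p.1 p.2, p.2⟩ : (_ : Finset ι) × ι) ∈ pointedSubsets K l := by
  rw [mem_pointedSubsets] at hp ⊢
  obtain ⟨⟨h1, h2⟩, h3⟩ := hp
  refine ⟨⟨Finset.sdiff_subset, ?_⟩, ?_⟩
  · simp only [coSubset]
    rw [Finset.card_sdiff_of_subset ((Finset.erase_subset _ _).trans h1),
      Finset.card_erase_of_mem h3]
    omega
  · simp [coSubset, h1 h3]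

lemma coSubset_coSubset {K V : Finset ι} (hV : V ⊆ K) {i : ι} (hi : i ∈ V) :
    coSubset K (coSubset K V i) i = V := by
  ext j
  have h1 := @hV j
  by_cases hj : j = i
  · subst hj; simp [coSubset, hi, hV hi]
  · simp only [coSubset, Finset.mem_sdiff, Finset.mem_erase]
    tauto

lemma erase_coSubset (K V : Finset ι) {i : ι} (hi : i ∈ V) :
    (coSubset K V i).erase i = K \ V := by
  ext j
  by_cases hj : j = i
  · subst hj; simp [hi]
  · simp only [coSubset, Finset.mem_sdiff, Finset.mem_erase]
    tauto

/-- `coSubset` with the point fixed is an involution of the pointed subsets; `|K| = 4l - 1` makes it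
preserve the size `2l`. -/
lemma sum_coSubset {K : Finset ι} (hK : K.card + 1 = 4 * l) (F : Finset ι → ι → ℝ) :
    ∑ p ∈ pointedSubsets K l, F (coSubset K p.1 p.2) p.2 = ∑ p ∈ pointedSubsets K l, F p.1 p.2 := by
  have hinv : ∀ p ∈ pointedSubsets K l,
      (⟨coSubset K (coSubset K p.1 p.2) p.2, p.2⟩ : (_ : Finset ι) × ι) = p := fun p hp => by
    rw [mem_pointedSubsets] at hp
    rw [coSubset_coSubset hp.1.1 hp.2]
  exact Finset.sum_nbij' (fun p => ⟨coSubset K p.1 p.2, p.2⟩) (fun p => ⟨coSubset K p.1 p.2, p.2⟩)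
    (fun p hp => coSubset_mem hK hp) (fun p hp => coSubset_mem hK hp) hinv hinv (fun p hp => rfl)

/-- The weight of the disjoint pairs of `l`-subsets of `K`, up to a constant. -/
def disjointWeight (K : Finset ι) (l : ℕ) (a b : Finset ι → ℝ) : ℝ :=
  ∑ p ∈ pointedSubsets K l, layerWeightOut l a p.1 p.2 * layerWeightOut l b (coSubset K p.1 p.2) p.2

/-- The weight of the pairs of `l`-subsets of `K` with one common element, up to a constant. -/
def meetingWeight (K : Finset ι) (l : ℕ) (a b : Finset ι → ℝ) : ℝ :=
  ∑ p ∈ pointedSubsets K l, layerWeightIn l a p.1 p.2 * layerWeightIn l b (coSubset K p.1 p.2) p.2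

lemma disjointWeight_comm {K : Finset ι} (hK : K.card + 1 = 4 * l) :
    disjointWeight K l b a = disjointWeight K l a b := by
  unfold disjointWeight
  rw [← sum_coSubset hK fun V i => layerWeightOut l b V i * layerWeightOut l a (coSubset K V i) i]
  refine Finset.sum_congr rfl fun p hp => ?_
  rw [mem_pointedSubsets] at hp
  rw [coSubset_coSubset hp.1.1 hp.2, mul_comm]

/-- The part of `disjointWeight` where the first set rarely contains the marked point. -/
lemma rare_disjointWeight_le {K : Finset ι} (hK : K.card + 1 = 4 * l)
    (ha0 : ∀ x, 0 ≤ a x) (ha1 : ∀ x, a x ≤ 1) (hb0 : ∀ x, 0 ≤ b x) (hb1 : ∀ x, b x ≤ 1) :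
    ∑ p ∈ pointedSubsets K l, (if layerWeightIn l a p.1 p.2 < layerWeightOut l a p.1 p.2 / 8
      then layerWeightOut l a p.1 p.2 * layerWeightOut l b (coSubset K p.1 p.2) p.2 else 0) ≤
    disjointWeight K l a b / 4 +
      (pointedSubsets K l).card * ((2 * l - 1).choose l * rareBound l) := by
  have hcard : ((pointedSubsets K l).card : ℝ) = ∑ V ∈ K.powersetCard (2 * l), (2 * l : ℝ) := by
    rw [pointedSubsets, Finset.card_sigma]
    push_cast
    refine Finset.sum_congr rfl fun V hV => ?_
    rw [(Finset.mem_powersetCard.1 hV).2]; push_cast; ring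
  rw [hcard, disjointWeight, pointedSubsets, Finset.sum_sigma, Finset.sum_sigma, Finset.sum_div,
    Finset.sum_mul, ← Finset.sum_add_distrib]
  refine Finset.sum_le_sum fun V hV => ?_
  rw [Finset.mem_powersetCard] at hV
  -- For fixed `V` the factor from `b` does not depend on `i`, so it leaves the sum over `i` and the
  -- one-sided bound applies.
  have hco : ∀ i ∈ V, layerWeightOut l b (coSubset K V i) i = layerWeight l b (K \ V) :=
    fun i hi => by rw [layerWeightOut_eq_layerWeight_erase, erase_coSubset K V hi]
  have hβ0 := layerWeight_nonneg (l := l) (V := K \ V) hb0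
  have hβ1 : layerWeight l b (K \ V) ≤ ((2 * l - 1).choose l : ℝ) := by
    have h := layerWeight_le_choose (l := l) (V := K \ V) hb1
    rwa [Finset.card_sdiff_of_subset hV.1, hV.2,
      show K.card - 2 * l = 2 * l - 1 by omega] at h
  have hη := rareBound_nonneg l
  calc _ = layerWeight l b (K \ V) * ∑ i ∈ V, (if layerWeightIn l a V i < layerWeightOut l a V i / 8
          then layerWeightOut l a V i else 0) := by
        rw [Finset.mul_sum]
        refine Finset.sum_congr rfl fun i hi => ?_
        simp only [hco i hi]
        split_ifs <;> ring
    _ ≤ layerWeight l b (K \ V) * ((∑ i ∈ V, layerWeightOut l a V i) / 4 + 2 * l * rareBound l) :=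
        mul_le_mul_of_nonneg_left (sum_layerWeightOut_rare_le ha0 ha1 hV.2) hβ0
    _ ≤ layerWeight l b (K \ V) * ((∑ i ∈ V, layerWeightOut l a V i) / 4) +
          2 * l * ((2 * l - 1).choose l * rareBound l) := by
        rw [mul_add]
        have : layerWeight l b (K \ V) * (2 * l * rareBound l) ≤
          ((2 * l - 1).choose l : ℝ) * (2 * l * rareBound l) := by gcongr
        linarith
    _ = _ := by
        congr 1
        rw [← mul_div_assoc, Finset.mul_sum]
        congr 1
        refine Finset.sum_congr rfl fun i hi => ?_
        rw [hco i hi, mul_comm]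

/-- Razborov's corruption bound for set disjointness. -/
lemma disjointWeight_le_meetingWeight {K : Finset ι} (hK : K.card + 1 = 4 * l)
    (ha0 : ∀ x, 0 ≤ a x) (ha1 : ∀ x, a x ≤ 1) (hb0 : ∀ x, 0 ≤ b x) (hb1 : ∀ x, b x ≤ 1) :
    disjointWeight K l a b / 128 ≤ meetingWeight K l a b +
      (pointedSubsets K l).card * ((2 * l - 1).choose l * rareBound l) / 32 := by
  have hA := rare_disjointWeight_le hK ha0 ha1 hb0 hb1
  have hB := rare_disjointWeight_le hK hb0 hb1 ha0 ha1
  rw [disjointWeight_comm hK, ← sum_coSubset hK fun V i =>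
    if layerWeightIn l b V i < layerWeightOut l b V i / 8 then
      layerWeightOut l b V i * layerWeightOut l a (coSubset K V i) i else 0] at hB
  -- Where neither side is rare, each loses at most a factor 8, hence 64. The two rare parts absorb
  -- half of `disjointWeight`, which turns 64 into 128.
  have key : disjointWeight K l a b ≤ 64 * meetingWeight K l a b +
      ∑ p ∈ pointedSubsets K l, (if layerWeightIn l a p.1 p.2 < layerWeightOut l a p.1 p.2 / 8
        then layerWeightOut l a p.1 p.2 * layerWeightOut l b (coSubset K p.1 p.2) p.2 else 0) +
      ∑ p ∈ pointedSubsets K l, (if layerWeightIn l b (coSubset K p.1 p.2) p.2 <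
          layerWeightOut l b (coSubset K p.1 p.2) p.2 / 8
        then layerWeightOut l b (coSubset K p.1 p.2) p.2 *
          layerWeightOut l a (coSubset K (coSubset K p.1 p.2) p.2) p.2 else 0) := by
    rw [meetingWeight, disjointWeight, Finset.mul_sum, ← Finset.sum_add_distrib,
      ← Finset.sum_add_distrib]
    refine Finset.sum_le_sum fun p hp => ?_
    rw [mem_pointedSubsets] at hp
    rw [coSubset_coSubset hp.1.1 hp.2]
    have h1 := layerWeightIn_nonneg (l := l) (V := p.1) ha0 p.2
    have h2 := layerWeightOut_nonneg (l := l) (V := p.1) ha0 p.2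
    have h3 := layerWeightIn_nonneg (l := l) (V := coSubset K p.1 p.2) hb0 p.2
    have h4 := layerWeightOut_nonneg (l := l) (V := coSubset K p.1 p.2) hb0 p.2
    have h5 := mul_nonneg h1 h3
    have h6 := mul_nonneg h2 h4
    split_ifs with hx hy hy
    · linarith
    · linarith
    · linarith
    · have := mul_le_mul (not_lt.1 hx) (not_lt.1 hy) (by positivity) h1
      linarith
  linarith

lemma card_filter_notMem_powersetCard (hV : V.card = 2 * l) {i : ι}
    (hi : i ∈ V) :
    ((V.powersetCard l).filter (fun x => i ∉ x)).card = (2 * l - 1).choose l := by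
  have : (V.powersetCard l).filter (fun x => i ∉ x) = (V.erase i).powersetCard l := by
    ext x
    simp only [Finset.mem_filter, Finset.mem_powersetCard, Finset.subset_erase]
    tauto
  rw [this, Finset.card_powersetCard, Finset.card_erase_of_mem hi, hV]

end Corruption

/-! ### Averaging over permutations. -/

section Symmetrization

variable {ι : Type*} [DecidableEq ι] [Fintype ι]

/-- The sum of `F` over all simultaneous permutations of `x` and `y`. -/
def permSum (F : Finset ι → Finset ι → ℝ) (x y : Finset ι) : ℝ :=
  ∑ σ : Equiv.Perm ι, F (x.map σ.toEmbedding) (y.map σ.toEmbedding)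

/-- The three cardinalities determine the sizes of all four Venn cells; the permutation is glued
from bijections between corresponding cells. -/
lemma exists_perm_map_eq {x y x' y' : Finset ι} (hx : x.card = x'.card) (hy : y.card = y'.card)
    (hxy : (x ∩ y).card = (x' ∩ y').card) :
    ∃ ρ : Equiv.Perm ι, x.map ρ.toEmbedding = x' ∧ y.map ρ.toEmbedding = y' := by
  classical
  let f : Finset ι → Finset ι → ι → Prop × Prop := fun x y j => (j ∈ x, j ∈ y)
  have hcard : ∀ c : Prop × Prop,
      Nonempty ({j // f x y j = c} ≃ {j // f x' y' j = c}) := by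
    rintro ⟨p, q⟩
    have hf : ∀ z w : Finset ι, ∀ j, f z w j = (p, q) ↔ ((j ∈ z ↔ p) ∧ (j ∈ w ↔ q)) :=
      fun z w j => by simp [f]
    have key : ∀ z w : Finset ι, Nonempty ({j // f z w j = (p, q)} ≃
        {j // j ∈ (if p then z else zᶜ) ∩ (if q then w else wᶜ)}) := fun z w =>
      ⟨Equiv.subtypeEquivRight fun j => by rw [hf]; split_ifs <;> simp [*]⟩
    obtain ⟨e1⟩ := key x y
    obtain ⟨e2⟩ := key x' y'
    have hc : ((if p then x else xᶜ) ∩ (if q then y else yᶜ)).card =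
        ((if p then x' else x'ᶜ) ∩ (if q then y' else y'ᶜ)).card := by
      have h1 := Finset.card_inter_add_card_sdiff x y
      have h2 := Finset.card_inter_add_card_sdiff x' y'
      have h3 := Finset.card_inter_add_card_sdiff y x
      have h4 := Finset.card_inter_add_card_sdiff y' x'
      have h5 := Finset.card_add_card_compl (x ∪ y)
      have h6 := Finset.card_add_card_compl (x' ∪ y')
      have h7 := Finset.card_union_add_card_inter x y
      have h8 := Finset.card_union_add_card_inter x' y'
      rw [Finset.inter_comm] at h3 h4
      split_ifs
      · exact hxy
      · rw [← Finset.sdiff_eq_inter_compl, ← Finset.sdiff_eq_inter_compl]; omega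
      · rw [Finset.inter_comm, Finset.inter_comm x'ᶜ, ← Finset.sdiff_eq_inter_compl,
          ← Finset.sdiff_eq_inter_compl]; omega
      · rw [← Finset.compl_union, ← Finset.compl_union]; omega
    exact ⟨(e1.trans (Finset.equivOfCardEq hc)).trans e2.symm⟩
  let ρ : Equiv.Perm ι := Equiv.ofFiberEquiv fun c => Classical.choice (hcard c)
  have hρ : ∀ j, f x' y' (ρ j) = f x y j := fun j => Equiv.ofFiberEquiv_map _ j
  refine ⟨ρ, ?_, ?_⟩
  · ext j
    have h := congrArg Prod.fst (hρ (ρ.symm j))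
    simp only [f, Equiv.apply_symm_apply] at h
    rw [Finset.mem_map_equiv, h]
  · ext j
    have h := congrArg Prod.snd (hρ (ρ.symm j))
    simp only [f, Equiv.apply_symm_apply] at h
    rw [Finset.mem_map_equiv, h]

lemma permSum_eq {F : Finset ι → Finset ι → ℝ} {x y x' y' : Finset ι} (hx : x.card = x'.card)
    (hy : y.card = y'.card) (hxy : (x ∩ y).card = (x' ∩ y').card) :
    permSum F x y = permSum F x' y' := by
  obtain ⟨ρ, rfl, rfl⟩ := exists_perm_map_eq hx hy hxy
  unfold permSum
  rw [← Equiv.sum_comp (Equiv.mulRight ρ)]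
  refine Finset.sum_congr rfl fun σ _ => ?_
  rw [Finset.map_map, Finset.map_map]
  rfl

lemma centralBinom_eq_two_mul_choose_pred {l : ℕ} (hl : 0 < l) :
    (2 * l).choose l = 2 * (2 * l - 1).choose l := by
  obtain ⟨m, rfl⟩ : ∃ m, l = m + 1 := ⟨l - 1, by omega⟩
  rw [show 2 * (m + 1) = (2 * m + 1) + 1 by ring, Nat.choose_succ_succ, Nat.add_sub_cancel,
    ← Nat.choose_symm_half]
  ring

lemma card_filter_mem_powersetCard {l : ℕ} (hl : 0 < l) {V : Finset ι} (hV : V.card = 2 * l)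
    {i : ι} (hi : i ∈ V) :
    ((V.powersetCard l).filter (fun x => i ∈ x)).card = (2 * l - 1).choose l := by
  have h := Finset.card_filter_add_card_filter_not (s := V.powersetCard l) (fun x => i ∈ x)
  rw [card_filter_notMem_powersetCard hV hi, Finset.card_powersetCard, hV,
    centralBinom_eq_two_mul_choose_pred hl] at h
  omega

/-- Symmetrizing a weighted count of configurations that all have the same three cardinalities. -/
lemma sum_perm_sum_mul_sum {l c : ℕ} {K w₁ w₂ x₀ y₀ : Finset ι} (a b : Finset ι → ℝ)
    (X Y : (_ : Finset ι) × ι → Finset (Finset ι))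
    (hX : ∀ p ∈ pointedSubsets K l, (X p).card = c) (hY : ∀ p ∈ pointedSubsets K l, (Y p).card = c)
    (hx : ∀ p ∈ pointedSubsets K l, ∀ x ∈ X p, ∀ y ∈ Y p,
      (x ∪ w₁).card = x₀.card ∧ (y ∪ w₂).card = y₀.card ∧
        ((x ∪ w₁) ∩ (y ∪ w₂)).card = (x₀ ∩ y₀).card) :
    ∑ σ : Equiv.Perm ι, ∑ p ∈ pointedSubsets K l,
      (∑ x ∈ X p, a ((x ∪ w₁).map σ.toEmbedding)) * (∑ y ∈ Y p, b ((y ∪ w₂).map σ.toEmbedding)) =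
    (pointedSubsets K l).card * (c * (c * permSum (fun x y => a x * b y) x₀ y₀)) := by
  rw [Finset.sum_comm, ← nsmul_eq_mul, ← Finset.sum_const]
  refine Finset.sum_congr rfl fun p hp => ?_
  simp only [Finset.sum_mul_sum]
  rw [Finset.sum_comm, ← nsmul_eq_mul, ← hX p hp, ← Finset.sum_const]
  refine Finset.sum_congr rfl fun x hxp => ?_
  rw [Finset.sum_comm, ← nsmul_eq_mul, hX p hp, ← hY p hp, ← Finset.sum_const]
  refine Finset.sum_congr rfl fun y hyp => ?_
  obtain ⟨h1, h2, h3⟩ := hx p hp x hxp y hyp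
  exact permSum_eq (F := fun x y => a x * b y) h1 h2 h3

/-- Expresses the error relative to the number of `l`-sets per pointed subset, using that the
central binomial coefficient is at least `4^l / (2l)`. -/
lemma rareBound_le {l : ℕ} (hl : 0 < l) :
    rareBound l ≤ (2 * l - 1).choose l * (8 * l * (97 / 108 : ℝ) ^ (l / 4)) := by
  have h := Nat.four_pow_le_two_mul_self_mul_centralBinom l hl
  rw [Nat.centralBinom_eq_two_mul_choose, centralBinom_eq_two_mul_choose_pred hl] at h
  have h' : (4 : ℝ) ^ l ≤ 2 * l * (2 * (2 * l - 1).choose l) := by exact_mod_cast h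
  unfold rareBound
  have hq : (0 : ℝ) ≤ (97 / 108 : ℝ) ^ (l / 4) := by positivity
  nlinarith [mul_le_mul_of_nonneg_right h' hq]

/-- The corruption bound for pairs of sets of prescribed cardinalities: a rectangle contains
almost as many pairs with one more common element. -/
lemma permSum_mul_le {l : ℕ} (hl : 0 < l) {x₀ y₀ x₁ y₁ : Finset ι}
    (hx : x₁.card = x₀.card) (hy : y₁.card = y₀.card)
    (hxy : (x₁ ∩ y₁).card = (x₀ ∩ y₀).card + 1)
    (h10 : l ≤ (x₀ \ y₀).card) (h01 : l ≤ (y₀ \ x₀).card) (h00 : 2 * l - 1 ≤ ((x₀ ∪ y₀)ᶜ).card)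
    {a b : Finset ι → ℝ}
    (ha0 : ∀ x, 0 ≤ a x) (ha1 : ∀ x, a x ≤ 1) (hb0 : ∀ x, 0 ≤ b x) (hb1 : ∀ x, b x ≤ 1) :
    permSum (fun x y => a x * b y) x₀ y₀ / 128 ≤ permSum (fun x y => a x * b y) x₁ y₁ +
      (Fintype.card ι).factorial * (l / 4 * (97 / 108 : ℝ) ^ (l / 4)) := by
  obtain ⟨P, hP, hPc⟩ := Finset.exists_subset_card_eq h10
  obtain ⟨Q, hQ, hQc⟩ := Finset.exists_subset_card_eq h01
  obtain ⟨Z, hZ, hZc⟩ := Finset.exists_subset_card_eq h00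
  have hP' : ∀ j ∈ P, j ∈ x₀ ∧ j ∉ y₀ := fun j hj => by simpa using hP hj
  have hQ' : ∀ j ∈ Q, j ∈ y₀ ∧ j ∉ x₀ := fun j hj => by simpa using hQ hj
  have hZ' : ∀ j ∈ Z, j ∉ x₀ ∧ j ∉ y₀ := fun j hj => by simpa using hZ hj
  -- Only `K` varies; the rest of `x₀` and `y₀` is frozen as `w₁` and `w₂`, which contributes
  -- exactly `x₀ ∩ y₀` to every intersection.
  set K := P ∪ Q ∪ Z with hKdef
  have hPQ : Disjoint P Q := Finset.disjoint_left.2 fun j h1 h2 => (hQ' j h2).2 (hP' j h1).1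
  have hPQZ : Disjoint (P ∪ Q) Z := Finset.disjoint_left.2 fun j h1 h2 => by
    rcases Finset.mem_union.1 h1 with h | h
    · exact (hZ' j h2).1 (hP' j h).1
    · exact (hZ' j h2).2 (hQ' j h).1
  have hK : K.card + 1 = 4 * l := by
    rw [hKdef, Finset.card_union_of_disjoint hPQZ, Finset.card_union_of_disjoint hPQ]; omega
  set w₁ := x₀ \ P with hw₁
  set w₂ := y₀ \ Q with hw₂
  have hPx : P ⊆ x₀ := fun j hj => (hP' j hj).1
  have hQy : Q ⊆ y₀ := fun j hj => (hQ' j hj).1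
  have hw₁c : w₁.card + l = x₀.card := by
    rw [hw₁, Finset.card_sdiff_of_subset hPx, hPc]
    have := Finset.card_le_card hPx
    omega
  have hw₂c : w₂.card + l = y₀.card := by
    rw [hw₂, Finset.card_sdiff_of_subset hQy, hQc]
    have := Finset.card_le_card hQy
    omega
  have hKw₁ : Disjoint K w₁ := Finset.disjoint_left.2 fun j h1 h2 => by
    rw [hw₁, Finset.mem_sdiff] at h2
    rw [hKdef, Finset.mem_union, Finset.mem_union] at h1
    rcases h1 with (h | h) | h
    · exact h2.2 h
    · exact (hQ' j h).2 h2.1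
    · exact (hZ' j h).1 h2.1
  have hKw₂ : Disjoint K w₂ := Finset.disjoint_left.2 fun j h1 h2 => by
    rw [hw₂, Finset.mem_sdiff] at h2
    rw [hKdef, Finset.mem_union, Finset.mem_union] at h1
    rcases h1 with (h | h) | h
    · exact (hP' j h).2 h2.1
    · exact h2.2 h
    · exact (hZ' j h).2 h2.1
  have hw : w₁ ∩ w₂ = x₀ ∩ y₀ := by
    ext j
    have h1 := hP' j
    have h2 := hQ' j
    simp only [hw₁, hw₂, Finset.mem_inter, Finset.mem_sdiff]
    tauto
  have hcards : ∀ x ⊆ K, ∀ y ⊆ K, x.card = l → y.card = l →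
      (x ∪ w₁).card = x₀.card ∧ (y ∪ w₂).card = y₀.card ∧
        ((x ∪ w₁) ∩ (y ∪ w₂)).card = (x ∩ y).card + (x₀ ∩ y₀).card := by
    intro x hxK y hyK hxc hyc
    refine ⟨?_, ?_, ?_⟩
    · rw [Finset.card_union_of_disjoint (Finset.disjoint_of_subset_left hxK hKw₁)]; omega
    · rw [Finset.card_union_of_disjoint (Finset.disjoint_of_subset_left hyK hKw₂)]; omega
    · rw [← hw, ← Finset.card_union_of_disjoint]
      · congr 1
        ext j
        have h1 : j ∈ x → j ∉ w₂ := fun h => Finset.disjoint_left.1 hKw₂ (hxK h)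
        have h2 : j ∈ y → j ∉ w₁ := fun h => Finset.disjoint_left.1 hKw₁ (hyK h)
        simp only [Finset.mem_inter, Finset.mem_union]
        tauto
      · exact Finset.disjoint_of_subset_left (Finset.inter_subset_left.trans hxK)
          (Finset.disjoint_of_subset_right Finset.inter_subset_left hKw₁)
  have hc : (0 : ℝ) < (2 * l - 1).choose l := by
    exact_mod_cast Nat.choose_pos (by omega)
  have hN : (0 : ℝ) < (pointedSubsets K l).card := by
    obtain ⟨V, hVK, hV⟩ := Finset.exists_subset_card_eq (s := K) (n := 2 * l) (by omega)
    obtain ⟨i, hi⟩ := Finset.card_pos.1 (by omega : 0 < V.card)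
    exact_mod_cast Finset.card_pos.2 ⟨⟨V, i⟩, mem_pointedSubsets.2 ⟨⟨hVK, hV⟩, hi⟩⟩
  have hco : ∀ p ∈ pointedSubsets K l,
      (coSubset K p.1 p.2).card = 2 * l ∧ p.2 ∈ coSubset K p.1 p.2 := fun p hp => by
    have := mem_pointedSubsets.1 (coSubset_mem hK hp)
    exact ⟨this.1.2, this.2⟩
  have hcap : ∀ p ∈ pointedSubsets K l, ∀ j, j ∈ p.1 → j ∈ coSubset K p.1 p.2 → j = p.2 :=
    fun p hp j h1 h2 => by
      by_contra h
      simp [coSubset, h1, h] at h2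
  have hdisj := sum_perm_sum_mul_sum (l := l) (c := (2 * l - 1).choose l) (K := K) (w₁ := w₁)
    (w₂ := w₂) (x₀ := x₀) (y₀ := y₀) a b
    (fun p => (p.1.powersetCard l).filter (fun x => p.2 ∉ x))
    (fun p => ((coSubset K p.1 p.2).powersetCard l).filter (fun x => p.2 ∉ x))
    (fun p hp => card_filter_notMem_powersetCard (mem_pointedSubsets.1 hp).1.2
      (mem_pointedSubsets.1 hp).2)
    (fun p hp => card_filter_notMem_powersetCard (hco p hp).1 (hco p hp).2)
    (fun p hp x hx y hy => by
      simp only [Finset.mem_filter, Finset.mem_powersetCard] at hx hy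
      obtain ⟨h1, h2, h3⟩ := hcards x (hx.1.1.trans (mem_pointedSubsets.1 hp).1.1) y
        (hy.1.1.trans Finset.sdiff_subset) hx.1.2 hy.1.2
      have h4 : x ∩ y = ∅ := Finset.disjoint_iff_inter_eq_empty.1 <|
        Finset.disjoint_left.2 fun j hj1 hj2 => hx.2 <| by
          rwa [← hcap p hp j (hx.1.1 hj1) (hy.1.1 hj2)]
      refine ⟨h1, h2, ?_⟩
      rw [h3, h4]; simp)
  have hmeet := sum_perm_sum_mul_sum (l := l) (c := (2 * l - 1).choose l) (K := K) (w₁ := w₁)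
    (w₂ := w₂) (x₀ := x₁) (y₀ := y₁) a b
    (fun p => (p.1.powersetCard l).filter (fun x => p.2 ∈ x))
    (fun p => ((coSubset K p.1 p.2).powersetCard l).filter (fun x => p.2 ∈ x))
    (fun p hp => card_filter_mem_powersetCard hl (mem_pointedSubsets.1 hp).1.2
      (mem_pointedSubsets.1 hp).2)
    (fun p hp => card_filter_mem_powersetCard hl (hco p hp).1 (hco p hp).2)
    (fun p hp x hx' y hy' => by
      simp only [Finset.mem_filter, Finset.mem_powersetCard] at hx' hy'
      obtain ⟨h1, h2, h3⟩ := hcards x (hx'.1.1.trans (mem_pointedSubsets.1 hp).1.1) y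
        (hy'.1.1.trans Finset.sdiff_subset) hx'.1.2 hy'.1.2
      have h4 : x ∩ y = {p.2} := by
        ext j
        rw [Finset.mem_inter, Finset.mem_singleton]
        refine ⟨fun h => hcap p hp j (hx'.1.1 h.1) (hy'.1.1 h.2), ?_⟩
        rintro rfl
        exact ⟨hx'.2, hy'.2⟩
      refine ⟨h1.trans hx.symm, h2.trans hy.symm, ?_⟩
      rw [h3, h4, hxy, Finset.card_singleton, add_comm])
  -- The corruption bound for each permuted copy of the frozen configuration, summed. Symmetry
  -- collapses both weights to the same multiple of a `permSum`.
  have hcore : ∑ σ : Equiv.Perm ι, disjointWeight K l (fun x => a ((x ∪ w₁).map σ.toEmbedding))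
      (fun y => b ((y ∪ w₂).map σ.toEmbedding)) / 128 ≤
      ∑ σ : Equiv.Perm ι, (meetingWeight K l (fun x => a ((x ∪ w₁).map σ.toEmbedding))
      (fun y => b ((y ∪ w₂).map σ.toEmbedding)) +
      (pointedSubsets K l).card * ((2 * l - 1).choose l * rareBound l) / 32) :=
    Finset.sum_le_sum fun σ _ => disjointWeight_le_meetingWeight hK (fun _ => ha0 _)
      (fun _ => ha1 _) (fun _ => hb0 _) (fun _ => hb1 _)
  simp only [disjointWeight, meetingWeight, layerWeightIn, layerWeightOut] at hcore
  rw [← Finset.sum_div, Finset.sum_add_distrib, hdisj, hmeet, Finset.sum_const, Finset.card_univ,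
    Fintype.card_perm, nsmul_eq_mul] at hcore
  have hr := rareBound_le hl
  set N : ℝ := ((pointedSubsets K l).card : ℝ)
  set c : ℝ := ((2 * l - 1).choose l : ℝ)
  set n! : ℝ := ((Fintype.card ι).factorial : ℝ) with hfac
  have hfac0 : 0 ≤ n! := Nat.cast_nonneg _
  refine le_of_mul_le_mul_left ?_ (mul_pos hN (mul_pos hc hc))
  have h7 : n! * (N * (c * rareBound l) / 32) ≤
      n! * (N * (c * (c * (8 * l * (97 / 108 : ℝ) ^ (l / 4)))) / 32) := by gcongr
  linarith

end Symmetrization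

/-! ### Corruption for sums of products, in both directions. -/

section RectangleSums

variable {ι κ : Type*} [DecidableEq ι] [Fintype ι] [Fintype κ]

lemma permSum_sum (a b : κ → Finset ι → ℝ) (x y : Finset ι) :
    permSum (fun x y => ∑ r, a r x * b r y) x y =
      ∑ r, permSum (fun x y => a r x * b r y) x y := by
  unfold permSum
  exact Finset.sum_comm

lemma permSum_mono {F G : Finset ι → Finset ι → ℝ} {x y : Finset ι}
    (h : ∀ σ : Equiv.Perm ι, F (x.map σ.toEmbedding) (y.map σ.toEmbedding) ≤
      G (x.map σ.toEmbedding) (y.map σ.toEmbedding)) : permSum F x y ≤ permSum G x y :=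
  Finset.sum_le_sum fun σ _ => h σ

lemma permSum_const_mul (c : ℝ) (F : Finset ι → Finset ι → ℝ) (x y : Finset ι) :
    permSum (fun x y => c * F x y) x y = c * permSum F x y :=
  (Finset.mul_sum _ _ _).symm

/-- The error term in the corruption bound. -/
noncomputable def corruptionError (l : ℕ) : ℝ := l / 4 * (97 / 108 : ℝ) ^ (l / 4)

lemma permSum_sum_mul_le {l : ℕ} (hl : 0 < l) {x₀ y₀ x₁ y₁ : Finset ι}
    (hx : x₁.card = x₀.card) (hy : y₁.card = y₀.card)
    (hxy : (x₁ ∩ y₁).card = (x₀ ∩ y₀).card + 1)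
    (h10 : l ≤ (x₀ \ y₀).card) (h01 : l ≤ (y₀ \ x₀).card) (h00 : 2 * l - 1 ≤ ((x₀ ∪ y₀)ᶜ).card)
    {a b : κ → Finset ι → ℝ} (ha0 : ∀ r x, 0 ≤ a r x) (ha1 : ∀ r x, a r x ≤ 1)
    (hb0 : ∀ r x, 0 ≤ b r x) (hb1 : ∀ r x, b r x ≤ 1) :
    permSum (fun x y => ∑ r, a r x * b r y) x₀ y₀ / 128 ≤
      permSum (fun x y => ∑ r, a r x * b r y) x₁ y₁ +
      Fintype.card κ * ((Fintype.card ι).factorial * corruptionError l) := by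
  rw [permSum_sum, permSum_sum, Finset.sum_div, ← nsmul_eq_mul, ← Finset.card_univ,
    ← Finset.sum_const, ← Finset.sum_add_distrib]
  exact Finset.sum_le_sum fun r _ => permSum_mul_le hl hx hy hxy h10 h01 h00 (ha0 r) (ha1 r)
    (hb0 r) (hb1 r)

lemma map_compl_perm (σ : Equiv.Perm ι) (x : Finset ι) :
    xᶜ.map σ.toEmbedding = (x.map σ.toEmbedding)ᶜ := by
  ext j
  simp [Finset.mem_map_equiv]

/-- Complementing the second set exchanges the two directions of the corruption bound. -/
lemma permSum_sum_mul_le_compl {l : ℕ} (hl : 0 < l) {x₀ y₀ x₁ y₁ : Finset ι}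
    (hx : x₁.card = x₀.card) (hy : y₁.card = y₀.card)
    (hxy : (x₁ ∩ y₁).card = (x₀ ∩ y₀).card + 1)
    (h11 : l ≤ (x₁ ∩ y₁).card) (h00 : l ≤ ((x₁ ∪ y₁)ᶜ).card) (h01 : 2 * l - 1 ≤ (y₁ \ x₁).card)
    {a b : κ → Finset ι → ℝ} (ha0 : ∀ r x, 0 ≤ a r x) (ha1 : ∀ r x, a r x ≤ 1)
    (hb0 : ∀ r x, 0 ≤ b r x) (hb1 : ∀ r x, b r x ≤ 1) :
    permSum (fun x y => ∑ r, a r x * b r y) x₁ y₁ / 128 ≤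
      permSum (fun x y => ∑ r, a r x * b r y) x₀ y₀ +
      Fintype.card κ * ((Fintype.card ι).factorial * corruptionError l) := by
  have hcompl : ∀ x y : Finset ι, permSum (fun x y => ∑ r, a r x * b r y) x y =
      permSum (fun x y => ∑ r, a r x * b r yᶜ) x yᶜ := fun x y => by
    simp [permSum, map_compl_perm]
  rw [hcompl x₁, hcompl x₀]
  -- With `|x|` fixed, one more common point with `y` is one fewer with `yᶜ`, so the roles of the
  -- two pairs swap.
  refine permSum_sum_mul_le (b := fun r y => b r yᶜ) hl hx.symm ?_ ?_ ?_ ?_ ?_ ha0 ha1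
    (fun r x => hb0 r _) (fun r x => hb1 r _)
  · rw [Finset.card_compl, Finset.card_compl, hy]
  · rw [← Finset.sdiff_eq_inter_compl, ← Finset.sdiff_eq_inter_compl]
    have h1 := Finset.card_inter_add_card_sdiff x₀ y₀
    have h2 := Finset.card_inter_add_card_sdiff x₁ y₁
    omega
  · rwa [Finset.sdiff_eq_inter_compl, compl_compl]
  · rwa [Finset.sdiff_eq_inter_compl, ← Finset.compl_union, Finset.union_comm]
  · rwa [Finset.compl_union, compl_compl, Finset.inter_comm, ← Finset.sdiff_eq_inter_compl]

lemma exists_card_eq_card_inter_eq {p j : ℕ} (hj : j ≤ p) (hp : 2 * p ≤ Fintype.card ι + j) :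
    ∃ x y : Finset ι, x.card = p ∧ y.card = p ∧ (x ∩ y).card = j := by
  obtain ⟨x, -, hx⟩ := Finset.exists_subset_card_eq (s := (Finset.univ : Finset ι)) (n := p)
    (by rw [Finset.card_univ]; omega)
  obtain ⟨c, hc, hcj⟩ := Finset.exists_subset_card_eq (s := x) (n := j) (by omega)
  obtain ⟨d, hd, hdj⟩ := Finset.exists_subset_card_eq (s := xᶜ) (n := p - j)
    (by rw [Finset.card_compl]; omega)
  have hd' : ∀ i ∈ d, i ∉ x := fun i hi => Finset.mem_compl.1 (hd hi)
  refine ⟨x, c ∪ d, hx, ?_, ?_⟩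
  · rw [Finset.card_union_of_disjoint (Finset.disjoint_left.2 fun i h1 h2 => hd' i h2 (hc h1))]
    omega
  · rw [← hcj]
    congr 1
    ext i
    have h1 := @hc i
    have h2 := hd' i
    simp only [Finset.mem_inter, Finset.mem_union]
    tauto

end RectangleSums

/-! ### Lower bound for approximate covers of `MAJ`. -/

section Covers

variable {n : ℕ}

/-- The indicator string of a set. -/
def indicatorString (x : Finset (Fin n)) : BitString n := fun j => decide (j ∈ x)

lemma MAJ_indicatorString (x y : Finset (Fin n)) :
    MAJ n (indicatorString x) (indicatorString y) = decide (n ≤ 2 * (x ∩ y).card) := by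
  have h : ∑ i, (indicatorString x i && indicatorString y i).toNat = (x ∩ y).card := by
    have h' : ∀ i, (indicatorString x i && indicatorString y i).toNat =
        if i ∈ x ∩ y then 1 else 0 := fun i => by
      by_cases h1 : i ∈ x <;> by_cases h2 : i ∈ y <;> simp [indicatorString, h1, h2]
    simp only [h', Finset.sum_boole, Finset.filter_univ_mem, Nat.cast_id]
  unfold MAJ
  rw [h, decide_eq_decide, div_le_iff₀ (by norm_num)]
  rw [mul_comm]
  exact_mod_cast Iff.rfl

/-- The number of adjacent rectangles with label `v`, as a sum of products. -/
lemma exists_adjacentCount_eq_sum (C : Multiset (LabeledRectangle n)) (v : Bool) :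
    ∃ (κ : Type) (_ : Fintype κ) (a b : κ → Finset (Fin n) → ℝ), Fintype.card κ = C.card ∧
      (∀ r x, 0 ≤ a r x) ∧ (∀ r x, a r x ≤ 1) ∧ (∀ r x, 0 ≤ b r x) ∧ (∀ r x, b r x ≤ 1) ∧
      ∀ x y, (adjacentCount C v (indicatorString x) (indicatorString y) : ℝ) =
        ∑ r, a r x * b r y := by
  classical
  refine ⟨C, inferInstance,
    fun r x => if indicatorString x ∈ r.1.rows ∧ r.1.label = v then 1 else 0,
    fun r y => if indicatorString y ∈ r.1.cols then 1 else 0, Multiset.card_coe C,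
    fun r x => by positivity, fun r x => by dsimp only; split_ifs <;> norm_num,
    fun r x => by positivity, fun r x => by dsimp only; split_ifs <;> norm_num, fun x y => ?_⟩
  unfold adjacentCount
  conv_lhs => rw [← Multiset.map_univ_coe C, Multiset.countP_map]
  rw [← Finset.filter_val, Finset.card_val, Finset.card_filter]
  push_cast
  refine Finset.sum_congr rfl fun r _ => ?_
  rw [ite_zero_mul_ite_zero, mul_one]
  refine if_congr ?_ rfl rfl
  unfold LabeledRectangle.Adjacent
  tauto

/-- Amplification: expanding the power gives one product per `k`-tuple of rectangles, and an
intersection of rectangles is a rectangle. -/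
lemma exists_adjacentCount_pow_eq_sum (C : Multiset (LabeledRectangle n)) (v : Bool) (k : ℕ) :
    ∃ (κ : Type) (_ : Fintype κ) (a b : κ → Finset (Fin n) → ℝ), Fintype.card κ = C.card ^ k ∧
      (∀ r x, 0 ≤ a r x) ∧ (∀ r x, a r x ≤ 1) ∧ (∀ r x, 0 ≤ b r x) ∧ (∀ r x, b r x ≤ 1) ∧
      ∀ x y, (adjacentCount C v (indicatorString x) (indicatorString y) : ℝ) ^ k =
        ∑ r, a r x * b r y := by
  obtain ⟨κ, _, a, b, hκ, ha0, ha1, hb0, hb1, h⟩ := exists_adjacentCount_eq_sum C v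
  classical
  refine ⟨Fin k → κ, inferInstance, fun r x => ∏ i, a (r i) x, fun r y => ∏ i, b (r i) y,
    by simp [hκ], fun r x => Finset.prod_nonneg fun i _ => ha0 _ _,
    fun r x => Finset.prod_le_one (fun i _ => ha0 _ _) fun i _ => ha1 _ _,
    fun r x => Finset.prod_nonneg fun i _ => hb0 _ _,
    fun r x => Finset.prod_le_one (fun i _ => hb0 _ _) fun i _ => hb1 _ _, fun x y => ?_⟩
  rw [h, Fintype.sum_pow]
  simp only [Finset.prod_mul_distrib]

lemma adjacentCount_add (C : Multiset (LabeledRectangle n)) (x y : BitString n) (v : Bool) :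
    C.countP (fun R => R.Adjacent x y) = adjacentCount C v x y + adjacentCount C (!v) x y := by
  classical
  unfold adjacentCount
  rw [Multiset.countP_eq_countP_filter_add C _ (fun R => R.label = v), Multiset.countP_filter,
    Multiset.countP_filter]
  congr 1
  refine Multiset.countP_congr rfl fun R _ => ?_
  cases R.label <;> cases v <;> simp

lemma IsApproxMajorityCover.three_mul_le {f : BitString n → BitString n → Bool}
    {C : Multiset (LabeledRectangle n)} (hC : IsApproxMajorityCover f C) {x y : BitString n}
    {v : Bool} (hf : f x y = v) :
    3 * (adjacentCount C (!v) x y : ℝ) ≤ adjacentCount C v x y := by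
  have h := hC.2 x y
  rw [adjacentCount_add C x y v, hf] at h
  push_cast at h
  have h' : 3 * (adjacentCount C (!v) x y : ℚ) ≤ adjacentCount C v x y := by linarith
  exact_mod_cast h'

lemma one_le_of_isApproxMajorityCover (hn : 12 ≤ n) {C : Multiset (LabeledRectangle n)}
    (hC : IsApproxMajorityCover (MAJ n) C) :
    1 ≤ 300 * ((C.card : ℝ) ^ 5 * corruptionError (n / 12)) := by
  set l := n / 12 with hl
  -- `k + 1` is `n/2` rounded up, the least intersection size at which `MAJ` is 1. Set size `k + 2l`
  -- leaves `2l` or `2l - 1` points in each difference and, as `12l ≤ n`, enough points outside the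
  -- union.
  obtain ⟨k, hk⟩ : ∃ k, k + 1 = (n + 1) / 2 := ⟨(n + 1) / 2 - 1, by omega⟩
  obtain ⟨x₀, y₀, hx₀, hy₀, hxy₀⟩ := exists_card_eq_card_inter_eq (ι := Fin n) (p := k + 2 * l)
    (j := k) (by omega) (by rw [Fintype.card_fin]; omega)
  obtain ⟨x₁, y₁, hx₁, hy₁, hxy₁⟩ := exists_card_eq_card_inter_eq (ι := Fin n) (p := k + 2 * l)
    (j := k + 1) (by omega) (by rw [Fintype.card_fin]; omega)
  let T : Bool → Finset (Fin n) → Finset (Fin n) → ℝ := fun v x y =>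
    (adjacentCount C v (indicatorString x) (indicatorString y) : ℝ) ^ 5
  have hcap : ∀ (σ : Equiv.Perm (Fin n)) (x y : Finset (Fin n)),
      (x.map σ.toEmbedding ∩ y.map σ.toEmbedding).card = (x ∩ y).card := fun σ x y => by
    rw [← Finset.map_inter, Finset.card_map]
  have hM₀ : ∀ σ : Equiv.Perm (Fin n), MAJ n (indicatorString (x₀.map σ.toEmbedding))
      (indicatorString (y₀.map σ.toEmbedding)) = false := fun σ => by
    rw [MAJ_indicatorString, hcap, decide_eq_false_iff_not]; omega
  have hM₁ : ∀ σ : Equiv.Perm (Fin n), MAJ n (indicatorString (x₁.map σ.toEmbedding))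
      (indicatorString (y₁.map σ.toEmbedding)) = true := fun σ => by
    rw [MAJ_indicatorString, hcap, decide_eq_true_iff]; omega
  have hpow : ∀ {s t : ℝ}, 0 ≤ s → 3 * s ≤ t → 243 * s ^ 5 ≤ t ^ 5 := fun {s t} hs h => by
    calc 243 * s ^ 5 = (3 * s) ^ 5 := by ring
      _ ≤ t ^ 5 := by gcongr
  have h0 : 243 * permSum (T true) x₀ y₀ ≤ permSum (T false) x₀ y₀ := by
    rw [← permSum_const_mul]
    refine permSum_mono fun σ => ?_
    have h := hC.three_mul_le (hM₀ σ)
    exact hpow (Nat.cast_nonneg _) h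
  have h1 : 243 * permSum (T false) x₁ y₁ ≤ permSum (T true) x₁ y₁ := by
    rw [← permSum_const_mul]
    refine permSum_mono fun σ => ?_
    have h := hC.three_mul_le (hM₁ σ)
    exact hpow (Nat.cast_nonneg _) h
  -- Ties favor 1, so a 0-input lies in at least one rectangle labeled 0.
  have hbase : (n.factorial : ℝ) ≤ permSum (T false) x₀ y₀ := by
    have : permSum (fun _ _ => 1) x₀ y₀ = (n.factorial : ℝ) := by
      simp [permSum, Fintype.card_perm]
    rw [← this]
    refine permSum_mono fun σ => one_le_pow₀ ?_
    have h := not_le.1 fun hle => Bool.false_ne_true ((hM₀ σ).symm.trans ((hC.1 _ _).2 hle))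
    exact_mod_cast Nat.one_le_iff_ne_zero.2 (Nat.ne_zero_of_lt h)
  have c1 := Finset.card_inter_add_card_sdiff x₀ y₀
  have c2 := Finset.card_inter_add_card_sdiff y₀ x₀
  have c3 := Finset.card_add_card_compl (x₀ ∪ y₀)
  have c4 := Finset.card_union_add_card_inter x₀ y₀
  have d2 := Finset.card_inter_add_card_sdiff y₁ x₁
  have d3 := Finset.card_add_card_compl (x₁ ∪ y₁)
  have d4 := Finset.card_union_add_card_inter x₁ y₁
  rw [Finset.inter_comm] at c2 d2
  rw [Fintype.card_fin] at c3 d3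
  have up : permSum (T false) x₀ y₀ / 128 ≤ permSum (T false) x₁ y₁ +
      (C.card : ℝ) ^ 5 * (n.factorial * corruptionError l) := by
    obtain ⟨κ, _, a, b, hκ, ha0, ha1, hb0, hb1, h⟩ := exists_adjacentCount_pow_eq_sum C false 5
    have := permSum_sum_mul_le (l := l) (by omega) (x₀ := x₀) (y₀ := y₀) (x₁ := x₁) (y₁ := y₁)
      (by omega) (by omega) (by omega) (by omega) (by omega) (by omega) ha0 ha1 hb0 hb1
    simpa only [T, h, hκ, Fintype.card_fin, Nat.cast_pow] using this
  have down : permSum (T true) x₁ y₁ / 128 ≤ permSum (T true) x₀ y₀ +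
      (C.card : ℝ) ^ 5 * (n.factorial * corruptionError l) := by
    obtain ⟨κ, _, a, b, hκ, ha0, ha1, hb0, hb1, h⟩ := exists_adjacentCount_pow_eq_sum C true 5
    have := permSum_sum_mul_le_compl (l := l) (by omega) (x₀ := x₀) (y₀ := y₀) (x₁ := x₁)
      (y₁ := y₁) (by omega) (by omega) (by omega) (by omega) (by omega) (by omega) ha0 ha1 hb0 hb1
    simpa only [T, h, hκ, Fintype.card_fin, Nat.cast_pow] using this
  have hfac : (0 : ℝ) < n.factorial := by exact_mod_cast n.factorial_pos
  -- Chaining `up`, `h1`, `down`, `h0` gives `(1/128 - 128/243^2) * permSum (T false) x₀ y₀ ≤ (1 +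
  -- 128/243) * error`; the quotient of the constants is below 300.
  refine le_of_mul_le_mul_left ?_ hfac
  linarith

/-! ### A linear-size majority cover of `MAJ`. -/

/-- The cover of `MAJ` by the rectangles `{x | x i} × {y | y i}`, each taken twice, and by `n`
copies of the whole matrix. -/
def majCover (n : ℕ) : Multiset (LabeledRectangle n) :=
  2 • (Finset.univ : Finset (Fin n)).val.map (fun i =>
    ⟨Finset.univ.filter fun x => x i = true, Finset.univ.filter fun y => y i = true, true⟩) +
  (Finset.univ : Finset (Fin n)).val.map (fun _ => ⟨Finset.univ, Finset.univ, false⟩)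

lemma card_majCover (n : ℕ) : (majCover n).card = 3 * n := by
  simp [majCover]
  ring

lemma isMajorityCover_majCover (n : ℕ) : IsMajorityCover (MAJ n) (majCover n) := by
  intro x y
  have h0 : adjacentCount (majCover n) false x y = n := by
    unfold adjacentCount majCover
    rw [Multiset.countP_add, Multiset.countP_nsmul, Multiset.countP_map, Multiset.countP_map]
    simp [LabeledRectangle.Adjacent]
  have h1 : adjacentCount (majCover n) true x y = 2 * ∑ i, (x i && y i).toNat := by
    have h : ∀ i, (x i && y i).toNat = if x i = true ∧ y i = true then 1 else 0 := fun i => by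
      cases x i <;> cases y i <;> rfl
    unfold adjacentCount majCover
    rw [Multiset.countP_add, Multiset.countP_nsmul, Multiset.countP_map, Multiset.countP_map,
      ← Finset.filter_val, ← Finset.filter_val, Finset.card_val, Finset.card_val]
    simp [LabeledRectangle.Adjacent, h]
  rw [h0, h1, MAJ, decide_eq_true_iff, div_le_iff₀ (by norm_num), mul_comm]
  exact_mod_cast Iff.rfl

lemma minMajorityCover_MAJ_le (n : ℕ) : minMajorityCover (MAJ n) ≤ 3 * n :=
  Nat.sInf_le ⟨majCover n, isMajorityCover_majCover n, card_majCover n⟩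

lemma one_le_minApproxMajorityCover_MAJ (hn : 12 ≤ n) :
    1 ≤ 300 * ((minApproxMajorityCover (MAJ n) : ℝ) ^ 5 * corruptionError (n / 12)) := by
  obtain ⟨C, hC, hcard⟩ := Nat.sInf_mem (s := {s | ∃ C : Multiset (LabeledRectangle n),
    IsApproxMajorityCover (MAJ n) C ∧ C.card = s})
    (let ⟨C, hC⟩ := exists_isApproxMajorityCover (MAJ n); ⟨_, C, hC, rfl⟩)
  have := one_le_of_isApproxMajorityCover hn hC
  rwa [hcard] at this

end Covers

/-! ### Asymptotics. -/

lemma PP_MAJ_isBigO : (fun n : ℕ => PP (MAJ n)) =O[atTop] (fun n : ℕ => Real.log (n : ℝ)) := by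
  refine IsBigO.of_bound (2 / Real.log 2) ?_
  filter_upwards [eventually_ge_atTop 3] with n hn
  have h2 : 0 < Real.log 2 := Real.log_pos (by norm_num)
  have hle : (minMajorityCover (MAJ n) : ℝ) ≤ (n : ℝ) ^ 2 := by
    have h : minMajorityCover (MAJ n) ≤ n ^ 2 := (minMajorityCover_MAJ_le n).trans (by nlinarith)
    exact_mod_cast h
  have h0 : 0 ≤ Real.log (minMajorityCover (MAJ n)) := Real.log_natCast_nonneg _
  have hlog : Real.log (minMajorityCover (MAJ n)) ≤ 2 * Real.log n := by
    rcases Nat.eq_zero_or_pos (minMajorityCover (MAJ n)) with h | h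
    · rw [h]
      have := Real.log_natCast_nonneg n
      simpa using this
    · have := Real.log_le_log (by exact_mod_cast h) hle
      rwa [Real.log_pow, Nat.cast_ofNat] at this
  rw [PP, Real.logb, Real.norm_of_nonneg (div_nonneg h0 h2.le),
    Real.norm_of_nonneg (Real.log_natCast_nonneg n), div_mul_eq_mul_div]
  gcongr

lemma isBigO_APP_MAJ : (fun n : ℕ => (n : ℝ)) =O[atTop] (fun n : ℕ => APP (MAJ n)) := by
  set δ : ℝ := -Real.log (97 / 108) with hδdef
  have hδ : 0 < δ := neg_pos.2 (Real.log_neg (by norm_num) (by norm_num))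
  have hlittle : ∀ᶠ n : ℕ in atTop, Real.log (n : ℝ) ≤ δ / 400 * n := by
    have h := (Real.isLittleO_log_id_atTop.comp_tendsto tendsto_natCast_atTop_atTop).bound
      (show 0 < δ / 400 by positivity)
    filter_upwards [h] with n hn
    simp only [Function.comp_apply, id_eq, Real.norm_natCast] at hn
    exact (Real.le_norm_self _).trans hn
  have hlarge : ∀ᶠ n : ℕ in atTop, Real.log 300 + 2 * δ ≤ δ / 400 * n :=
    (tendsto_natCast_atTop_atTop.const_mul_atTop (show 0 < δ / 400 by positivity)).eventually_ge_atTop _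
  refine IsBigO.of_bound (5 * 100 / δ) ?_
  filter_upwards [hlittle, hlarge, eventually_ge_atTop 12] with n h1 h2 hn
  have h := one_le_minApproxMajorityCover_MAJ hn
  set s := minApproxMajorityCover (MAJ n) with hs
  have hspos : 0 < s := by
    rcases Nat.eq_zero_or_pos s with h0 | h0
    · rw [h0] at h; norm_num at h
    · exact h0
  have hspos' : (0 : ℝ) < s := by exact_mod_cast hspos
  have hnpos : (0 : ℝ) < n := by exact_mod_cast (by omega : 0 < n)
  have hle : (1 : ℝ) ≤ 300 * ((s : ℝ) ^ 5 * (n * (97 / 108 : ℝ) ^ (n / 12 / 4))) := by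
    refine h.trans ?_
    unfold corruptionError
    have : ((n / 12 : ℕ) : ℝ) / 4 ≤ n := by
      have h3 : ((n / 12 : ℕ) : ℝ) ≤ n := by exact_mod_cast Nat.div_le_self n 12
      have h4 : (0 : ℝ) ≤ ((n / 12 : ℕ) : ℝ) := Nat.cast_nonneg _
      linarith
    gcongr
  have hlog := Real.log_le_log one_pos hle
  rw [Real.log_one, Real.log_mul (by norm_num) (by positivity), Real.log_mul (by positivity)
    (by positivity), Real.log_mul (by positivity) (by positivity), Real.log_pow, Real.log_pow] at hlog
  have hfloor : (n : ℝ) / 48 - 1 ≤ ((n / 12 / 4 : ℕ) : ℝ) := by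
    have h3 : n ≤ 48 * (n / 12 / 4) + 48 := by omega
    have h4 : (n : ℝ) ≤ 48 * ((n / 12 / 4 : ℕ) : ℝ) + 48 := by exact_mod_cast h3
    linarith
  have hmul := mul_le_mul_of_nonneg_right hfloor hδ.le
  have hδn : 0 < δ * n := by positivity
  -- The decay contributes `δ (n/48 - 1)`; `log n` and the constants each cost at most `δ n / 400`,
  -- and `1/48 - 2/400 > 1/100`.
  have hs5 : δ / 100 * n ≤ 5 * Real.log s := by
    push_cast at hlog
    have : ((n / 12 / 4 : ℕ) : ℝ) * Real.log (97 / 108) = -(((n / 12 / 4 : ℕ) : ℝ) * δ) := by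
      rw [hδdef]; ring
    rw [this] at hlog
    linarith
  have hl2 : 0 < Real.log 2 := Real.log_pos (by norm_num)
  have hl2' : Real.log 2 ≤ 1 := by
    have := Real.log_two_lt_d9
    linarith
  have hls : 0 ≤ Real.log s := Real.log_natCast_nonneg s
  have hAPP : Real.log s ≤ APP (MAJ n) := by
    rw [APP, Real.logb, le_div_iff₀ hl2]
    nlinarith
  rw [Real.norm_natCast, Real.norm_of_nonneg (hls.trans hAPP), div_mul_eq_mul_div,
    le_div_iff₀ hδ]
  linarith

theorem mainTheorem6 :
    ((fun n : ℕ => PP (MAJ n)) =O[atTop] (fun n : ℕ => Real.log (n : ℝ))) ∧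
    ((fun n : ℕ => (n : ℝ)) =O[atTop] (fun n : ℕ => APP (MAJ n))) := by
  exact ⟨PP_MAJ_isBigO, isBigO_APP_MAJ⟩
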